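/- Let $A=(a_1,\dots,a_n)$ be a configuration of points of $\mathbb{R}^d$ (repetitions and affine dependencies allowed) whose affine span is $\mathbb{R}^d$, and put $v_i=(a_i,1)\in\mathbb{R}^{d+1}$. For disjoint $I,B\subseteq\{1,\dots,n\}$ with $(a_b)_{b\in B}$ affinely independent let $\Pi_{I,B}=\sum_{i\in I}v_i+\sum_{b\in B}[0,v_b]$; if $|B|=d+1$ call $|I|$ its order and say that it is supported on $x\in\mathbb{R}^d$ if $x\in\operatorname{conv}\{a_i : i\in I\sqcup B\}$. Let $h$ assign a real height $h_i$ to each index $i$, and assume that $h$ is generic: any $d+2$ of the points $(a_i,h_i)\in\mathbb{R}^{d+1}$ that are affinely dependent lie on a common hyperplane whose normal vector has last coordinate zero. Let $\mathcal{P}(h)$ be the associated regular fine zonotopal tiling of $\sum_{i=1}^n[0,v_i]$: its tiles are the $\Pi_{I,B}$ with $|B|=d+1$ for which $\sum_{i\in I}\tilde v_i+\sum_{b\in B}[0,\tilde v_b]$, where $\tilde v_i=(a_i,h_i,1)$, is a face of the zonotope $\sum_{i=1}^n[0,\tilde v_i]\subset\mathbb{R}^{d+2}$ having an outward normal vector with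 positive $(d+1)$-th coordinate. The facets of a tile $\Pi_{I,B}$ are the parallelepipeds $\Pi_{J,C}$ with $C=B\setminus\{b\}$ and $J=I$ or $J=I\sqcup\{b\}$, for some $b\in B$. A facet is internal if it is shared by two distinct tiles. Let $x\in\operatorname{conv}\{a_1,\dots,a_n\}$ be generic, i.e. $x\notin\operatorname{aff}\{a_c : c\in C\}$ for every internal facet $\Pi_{J,C}$ of $\mathcal{P}(h)$. The $x$-oriented adjacency graph has the tiles as vertices and, for each internal facet $\Pi_{J,C}$, an edge between the two tiles sharing it; with $N\ne 0$ a normal vector of the facet (so $\langle N,v_c\rangle=0$ for $c\in C$), the edge is directed $\Pi\to\Pi'$ if $\operatorname{sign}\langle N,(x,1)\rangle=\operatorname{sign}\langle N,z'-z\rangle$ for all interior points $z$ of $\Pi$ and $z'$ of $\Pi'$. Then there is exactly one tile $\Pi_{\varnothing,Z}$ of order $0$ in $\mathcal{P}(h)$ supported on $x$, and for every tile $\Pi_{I',B'}\in\mathcal{P}(h)$ supported on $x$ there is a directed path in the $x$-oriented adjacency graph from $\Pi_{\varnothing,Z}$ to $\Pi_{I',B'}$ such that every tile on the path is supported on $x$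 and has order at most $|I'|$. -/

import Mathlib

open scoped Matrix

noncomputable section

/-- The vector `(a, 1) ∈ ℝ^(m+1)` obtained from `a ∈ ℝ^m`. -/
def projLift {m : ℕ} (p : Fin m → ℝ) : Fin (m + 1) → ℝ :=
  Fin.snoc (α := fun _ => ℝ) p 1

/-- The point `(a_i, h_i) ∈ ℝ^(d+1)` over `a_i`. Heights are attached to indices, so that
repeated points of the configuration may have different heights. -/
def heightLift {n d : ℕ} (a : Fin n → Fin d → ℝ) (h : Fin n → ℝ) (i : Fin n) :
    Fin (d + 1) → ℝ :=
  Fin.snoc (α := fun _ => ℝ) (a i) (h i)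

/-- The height function `h` is generic: any `d + 2` of the lifted points `(a_i, h_i)` that are
affinely dependent lie on a vertical hyperplane of `ℝ^(d+1)`, that is, on a hyperplane whose
normal vector `N` has last coordinate zero. -/
def IsGenericHeight {n d : ℕ} (a : Fin n → Fin d → ℝ) (h : Fin n → ℝ) : Prop :=
  ∀ S : Finset (Fin n), S.card = d + 2 →
    ¬ AffineIndependent ℝ (fun i : S => heightLift a h i) →
    ∃ N : Fin (d + 1) → ℝ, N ≠ 0 ∧ N (Fin.last d) = 0 ∧
      ∃ c : ℝ, ∀ i ∈ S, N ⬝ᵥ heightLift a h i = c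

/-- The zonotope of a vector configuration: the Minkowski sum of the segments `[0, v_i]`. -/
def zonotope {n m : ℕ} (v : Fin n → Fin m → ℝ) : Set (Fin m → ℝ) :=
  {z | ∃ α : Fin n → ℝ, (∀ i, 0 ≤ α i ∧ α i ≤ 1) ∧ z = ∑ i, α i • v i}

/-- Index data `(I, B)`, with `I` and `B` disjoint, of a parallelepiped `Π_{I,B}`. -/
structure Cell (n : ℕ) where
  /-- the set `I` -/
  base : Finset (Fin n)
  /-- the set `B` -/
  dirs : Finset (Fin n)
  disj : Disjoint base dirs

/-- The order `|I|` of `Π_{I,B}`. -/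
def Cell.order {n : ℕ} (T : Cell n) : ℕ := T.base.card

/-- The parallelepiped `Π_{I,B} = ∑_{i ∈ I} v_i + ∑_{b ∈ B} [0, v_b]`. -/
def Cell.toSet {n m : ℕ} (T : Cell n) (v : Fin n → Fin m → ℝ) : Set (Fin m → ℝ) :=
  {z | ∃ α : Fin n → ℝ, (∀ b ∈ T.dirs, 0 ≤ α b ∧ α b ≤ 1) ∧
    z = ∑ i ∈ T.base, v i + ∑ b ∈ T.dirs, α b • v b}

/-- `F` is a face of `Z ⊆ ℝ^(d+2)` with an outward normal vector `y` whose `(d+1)`-th coordinate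
(the height coordinate, the last but one) is positive: `F` is the set of points of `Z` at which
the linear functional `⟨·, y⟩` is maximal. -/
def IsUpperFace {d : ℕ} (Z F : Set (Fin (d + 2) → ℝ)) : Prop :=
  ∃ y : Fin (d + 2) → ℝ, 0 < y (Fin.last d).castSucc ∧
    F = {z | z ∈ Z ∧ ∀ w ∈ Z, w ⬝ᵥ y ≤ z ⬝ᵥ y}

/-- The regular tiling `𝒫(h)`: the (full-dimensional) parallelepipeds `Π_{I,B}` that are the
projections of the faces `Π̃_{I,B}` in the upper convex hull of the zonotope built on the vectors
`(a_i, h_i, 1)`. -/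
def regularTiling {n d : ℕ} (a : Fin n → Fin d → ℝ) (h : Fin n → ℝ) : Set (Cell n) :=
  {T | T.dirs.card = d + 1 ∧ AffineIndependent ℝ (fun b : T.dirs => a b) ∧
    IsUpperFace (zonotope fun i => projLift (heightLift a h i))
      (T.toSet fun i => projLift (heightLift a h i))}

/-- `Π_{J,C} = F` is a facet of `Π_{I,B} = T`: for one `b ∈ B` the coefficient of `v_b` is set to
`0` (then `J = I`) or to `1` (then `J = I ⊔ {b}`), and `C = B \ {b}`. -/
def Cell.IsFacetOf {n : ℕ} (F T : Cell n) : Prop :=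
  ∃ b ∈ T.dirs, F.dirs = T.dirs.erase b ∧ (F.base = T.base ∨ F.base = insert b T.base)

/-- `F` is a facet shared by the two distinct tiles `T` and `T'` of `P`. -/
def IsSharedFacet {n : ℕ} (P : Set (Cell n)) (F T T' : Cell n) : Prop :=
  T ∈ P ∧ T' ∈ P ∧ T ≠ T' ∧ F.IsFacetOf T ∧ F.IsFacetOf T'

/-- The tile `Π_{I,B}` (with its spline) is supported on `x`: `x ∈ ch({a_i}_{i ∈ I ⊔ B})`. -/
def Cell.SupportedOn {n d : ℕ} (a : Fin n → Fin d → ℝ) (T : Cell n) (x : Fin d → ℝ) : Prop :=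
  x ∈ convexHull ℝ (a '' ((T.base ∪ T.dirs : Finset (Fin n)) : Set (Fin n)))

/-- `x` is generic with respect to `P`: it lies on no affine span `aff({a_c}_{c ∈ C})` for an
internal facet `Π_{J,C}` of `P`. -/
def IsGenericForTiling {n d : ℕ} (a : Fin n → Fin d → ℝ) (P : Set (Cell n)) (x : Fin d → ℝ) : Prop :=
  ∀ F T T' : Cell n, IsSharedFacet P F T T' →
    x ∉ affineSpan ℝ (a '' (F.dirs : Set (Fin n)))

/-- The adjacency graph of `P` with the orientation induced by `x`. There is an edge `T → T'` if
the tiles share a facet `Π_{J,C}` and `sign ⟨N, (x,1)⟩ = sign ⟨N, z' - z⟩` for the normal vectors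
`N` of that facet and all points `z`, `z'` in the interior of `T`, `T'`. -/
def orientedAdjacencyGraph {n d : ℕ} (a : Fin n → Fin d → ℝ) (P : Set (Cell n))
    (x : Fin d → ℝ) : Digraph (Cell n) where
  Adj T T' := ∃ F : Cell n, IsSharedFacet P F T T' ∧
    ∀ N : Fin (d + 1) → ℝ, N ≠ 0 → (∀ c ∈ F.dirs, N ⬝ᵥ projLift (a c) = 0) →
      ∀ z ∈ interior (T.toSet fun i => projLift (a i)),
        ∀ z' ∈ interior (T'.toSet fun i => projLift (a i)),
          SignType.sign (N ⬝ᵥ projLift x) = SignType.sign (N ⬝ᵥ (z' - z))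

/-- The list `p` is a directed path (without repeated vertices) from `s` to `t` in `G`. -/
def IsDirectedPath {V : Type*} (G : Digraph V) (s t : V) (p : List V) : Prop :=
  p.IsChain G.Adj ∧ p.Nodup ∧ p.head? = some s ∧ p.getLast? = some t

end

/-!
With `v_i = (a_i, 1)`, the upper faces of the lifted zonotope are governed by the arrangement of
the hyperplanes `{f | f v_i = h_i}` in the dual of `ℝ^(d+1)`: the tiles `Π_{I,B}` are its vertices
`f`, where `B` is the set of hyperplanes through `f` and `I` the set of `i` with `f v_i < h_i`, and
an internal facet is an edge joining two vertices. Along an arrow of the `x`-oriented graph the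
value `f (x, 1)` decreases.

If a tile is supported on `x` and `I` is nonempty, a ratio test on the conic combination
representing `(x, 1)` removes some `b ∈ B` from its support. Moving from `f` along the edge that
leaves the hyperplane of `b`, so as to increase `f (x, 1)`, ends at a supported vertex whose set
`I` is no larger. Repeating this, one arrives at a supported tile of order `0` after finitely many
steps. Such a tile minimizes `f (x, 1)` under the constraints `h_i ≤ f v_i`, and it is unique by
complementary slackness and the genericity of `x`.
-/

section LinearAlgebra

variable {K V ι : Type*} [Field K] [AddCommGroup V] [Module K V]

lemma exists_dual_eqOn {v : ι → V} {s : Set ι} (hs : LinearIndepOn K v s) (g : ι → K) :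
    ∃ f : Module.Dual K V, ∀ i ∈ s, f (v i) = g i := by
  have hs' : LinearIndependent K fun i : s => v i := hs
  obtain ⟨f, hf⟩ := LinearMap.exists_extend ((Module.Basis.span hs').constr K fun i : s => g i)
  refine ⟨f, fun i hi => ?_⟩
  have hfi := LinearMap.congr_fun hf (Module.Basis.span hs' ⟨i, hi⟩)
  rwa [Module.Basis.constr_basis, LinearMap.comp_apply, Submodule.subtype_apply,
    Module.Basis.span_apply] at hfi

lemma ker_eq_span_of_span_insert_eq_top {N : Module.Dual K V} {s : Set V} {y : V}
    (hs : ∀ z ∈ s, N z = 0) (hy : N y ≠ 0) (htop : Submodule.span K (insert y s) = ⊤) :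
    LinearMap.ker N = Submodule.span K s := by
  have hle : Submodule.span K s ≤ LinearMap.ker N := Submodule.span_le.2 hs
  refine le_antisymm (fun z hz => ?_) hle
  obtain ⟨t, z', hz', rfl⟩ := Submodule.mem_span_insert.1 (htop ▸ Submodule.mem_top : z ∈ _)
  have ht : t * N y = 0 := by
    simpa only [LinearMap.mem_ker, map_add, map_smul, smul_eq_mul, LinearMap.mem_ker.1 (hle hz'),
      add_zero] using hz
  simpa only [(mul_eq_zero.1 ht).resolve_right hy, zero_smul, zero_add] using hz'

lemma exists_dual_ker_eq_span_diff {v : ι → V} {s : Set ι} (hs : LinearIndepOn K v s)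
    (htop : Submodule.span K (v '' s) = ⊤) {b : ι} (hb : b ∈ s) :
    ∃ N : Module.Dual K V, N (v b) = 1 ∧
      LinearMap.ker N = Submodule.span K (v '' (s \ {b})) := by
  classical
  obtain ⟨N, hN⟩ := exists_dual_eqOn hs (Pi.single b 1)
  have hNb : N (v b) = 1 := by simpa using hN b hb
  refine ⟨N, hNb, ker_eq_span_of_span_insert_eq_top ?_ (hNb ▸ one_ne_zero) ?_⟩
  · rintro _ ⟨i, ⟨hi, hib⟩, rfl⟩
    rw [hN i hi, Pi.single_eq_of_ne hib]
  · rw [← Set.image_insert_eq, Set.insert_sdiff_self_of_mem hb, htop]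

lemma exists_eq_smul_of_span_insert_eq_top {M N : Module.Dual K V} {s : Set V} {y : V}
    (hM : ∀ z ∈ s, M z = 0) (hN : ∀ z ∈ s, N z = 0) (hN₀ : N ≠ 0)
    (htop : Submodule.span K (insert y s) = ⊤) : ∃ t : K, M = t • N := by
  have hNy : N y ≠ 0 := fun hNy => hN₀ <| LinearMap.ext_on htop <|
    Set.forall_mem_insert.2 ⟨hNy, hN⟩
  refine ⟨M y / N y, LinearMap.ext_on htop <| Set.forall_mem_insert.2 ⟨?_, fun z hz => ?_⟩⟩
  · simp [hNy]
  · simp [hM z hz, hN z hz]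

lemma span_insert_eq_top_of_dual {N : Module.Dual K V} {s : Set V} {y z : V}
    (hs : ∀ u ∈ s, N u = 0) (hz : N z ≠ 0) (htop : Submodule.span K (insert y s) = ⊤) :
    Submodule.span K (insert z s) = ⊤ := by
  have hzs : z ∉ Submodule.span K s := fun h =>
    hz (Submodule.span_le (p := LinearMap.ker N).2 hs h)
  have hy : y ∈ Submodule.span K (insert z s) :=
    mem_span_insert_exchange (htop ▸ Submodule.mem_top) hzs
  rw [eq_top_iff, ← htop, Submodule.span_le, Set.insert_subset_iff]
  exact ⟨hy, (Set.subset_insert z s).trans Submodule.subset_span⟩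

lemma eq_of_subset_of_span_eq_top {v : ι → V} {s t : Set ι} (ht : LinearIndepOn K v t)
    (hst : s ⊆ t) (htop : Submodule.span K (v '' s) = ⊤) : s = t := by
  refine hst.antisymm fun i hi => ?_
  by_contra his
  refine ((linearIndepOn_insert his).1 (ht.mono (Set.insert_subset hi hst))).2 ?_
  exact htop ▸ Submodule.mem_top

lemma exists_coeff_of_mem_span_image [Fintype ι] {v : ι → V} {s : Set ι} {y : V}
    (hy : y ∈ Submodule.span K (v '' s)) :
    ∃ g : ι → K, (∀ i ∉ s, g i = 0) ∧ ∑ i, g i • v i = y := by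
  obtain ⟨g, hg, rfl⟩ := (Finsupp.mem_span_image_iff_linearCombination K).1 hy
  refine ⟨g, fun i hi => ?_, ?_⟩
  · by_contra hgi
    exact hi (hg (Finsupp.mem_support_iff.2 hgi))
  · exact (Finsupp.sum_fintype g (fun i c => c • v i) fun i => zero_smul K (v i)).symm

lemma dual_apply_sum_smul_eq [Fintype ι] {v : ι → V} {s : Set ι} {N : Module.Dual K V}
    {b : ι} (hNb : N (v b) = 1) (hN : ∀ i ∈ s \ {b}, N (v i) = 0) {l : ι → K}
    (hl : ∀ i ∉ s, l i = 0) : N (∑ i, l i • v i) = l b := by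
  simp only [map_sum, map_smul, smul_eq_mul]
  rw [Finset.sum_eq_single b (fun i _ hib => ?_) (by simp), hNb, mul_one]
  by_cases hi : i ∈ s
  · rw [hN i ⟨hi, hib⟩, mul_zero]
  · rw [hl i hi, zero_mul]

lemma span_image_eq_top_iff_card_eq_finrank [FiniteDimensional K V] {v : ι → V}
    {s : Finset ι} (hs : LinearIndepOn K v (s : Set ι)) :
    Submodule.span K (v '' s) = ⊤ ↔ s.card = Module.finrank K V := by
  have hcard : Module.finrank K (Submodule.span K (v '' s)) = s.card := by
    rw [Set.image_eq_range]
    exact (finrank_span_eq_card hs).trans (Fintype.card_coe s)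
  rw [← hcard]
  exact ⟨fun htop => by rw [htop, finrank_top], Submodule.eq_top_of_finrank_eq⟩

end LinearAlgebra

section OrderedField

variable {K ι : Type*} [Field K] [LinearOrder K] [IsStrictOrderedRing K]

lemma mul_le_max_zero {α w : K} (hα : 0 ≤ α ∧ α ≤ 1) : α * w ≤ max w 0 := by
  rcases le_total w 0 with hw | hw
  · exact (mul_nonpos_of_nonneg_of_nonpos hα.1 hw).trans (le_max_right w 0)
  · exact (mul_le_of_le_one_left hw hα.2).trans (le_max_left w 0)

-- The ratio test of the simplex method.
lemma exists_add_mul_eq_zero_of_nonneg [Finite ι] {μ γ : ι → K} (hμ : ∀ i, 0 ≤ μ i)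
    (hγ : ∃ i, γ i < 0) :
    ∃ t : K, 0 ≤ t ∧ ∃ b, γ b < 0 ∧ μ b + t * γ b = 0 ∧ ∀ i, 0 ≤ μ i + t * γ i := by
  obtain ⟨b, hb, hmin⟩ := Set.exists_min_image {i | γ i < 0} (fun i => μ i / -γ i)
    (Set.toFinite _) hγ
  have hb' : 0 < -γ b := neg_pos.2 hb
  refine ⟨μ b / -γ b, div_nonneg (hμ b) hb'.le, b, hb, ?_, fun i => ?_⟩
  · rw [← neg_neg (γ b), mul_neg, neg_neg, div_mul_cancel₀ _ hb'.ne', add_neg_cancel]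
  · rcases lt_or_ge (γ i) 0 with hi | hi
    · have := (le_div_iff₀ (neg_pos.2 hi)).1 (hmin i hi)
      linarith
    · exact add_nonneg (hμ i) (mul_nonneg (div_nonneg (hμ b) hb'.le) hi)

lemma exists_pos_sub_mul_eq_zero [Finite ι] {w r : ι → K} (hwr : ∃ i, 0 < w i * r i) :
    ∃ s : K, 0 < s ∧ ∃ b, r b ≠ 0 ∧ w b ≠ 0 ∧ w b - s * r b = 0 ∧
      ∀ i, 0 ≤ w i * (w i - s * r i) := by
  obtain ⟨s, hs, b, hb, hb₀, hnonneg⟩ := exists_add_mul_eq_zero_of_nonneg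
    (μ := fun i => w i * w i) (γ := fun i => -(w i * r i)) (fun i => mul_self_nonneg (w i))
    (by simpa only [neg_lt_zero] using hwr)
  obtain ⟨hw, hr⟩ := mul_ne_zero_iff.1 (neg_lt_zero.1 hb).ne'
  have hwb : w b - s * r b = 0 := mul_left_cancel₀ hw (by linear_combination hb₀)
  refine ⟨s, hs.lt_of_ne fun hs₀ => hw ?_, b, hr, hw, hwb, fun i => ?_⟩
  · rwa [← hs₀, zero_mul, sub_zero] at hwb
  · have := hnonneg i
    linarith

end OrderedField

section DotProduct

variable {K ι κ : Type*} [Field K] [Fintype κ]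

lemma sum_smul_dotProduct [Fintype ι] (u : ι → κ → K) (α : ι → K) (y : κ → K) :
    (∑ i, α i • u i) ⬝ᵥ y = ∑ i, α i * (u i ⬝ᵥ y) := by
  simp only [sum_dotProduct, smul_dotProduct, smul_eq_mul]

lemma eq_zero_of_forall_dotProduct_eq_zero {u : ι → κ → K} {s : Set ι} {y : κ → K}
    (htop : Submodule.span K (u '' s) = ⊤) (hy : ∀ i ∈ s, u i ⬝ᵥ y = 0) : y = 0 := by
  classical
  refine (dotProductEquiv K κ).map_eq_zero_iff.1 (LinearMap.ext_on htop ?_)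
  rintro _ ⟨i, hi, rfl⟩
  simpa [dotProduct_comm y] using hy i hi

end DotProduct

section Interior

lemma dual_apply_lt_of_mem_interior {V : Type*} [AddCommGroup V] [Module ℝ V]
    [TopologicalSpace V] [ContinuousAdd V] [ContinuousSMul ℝ V] {D : StrongDual ℝ V} (hD : D ≠ 0)
    {S : Set V} {r : ℝ} (hS : ∀ y ∈ S, D y ≤ r) {z : V} (hz : z ∈ interior S) : D z < r := by
  have hopen : IsOpen (D '' interior S) := D.isOpenMap_of_ne_zero hD _ isOpen_interior
  have hsub : D '' interior S ⊆ interior (Set.Iic r) :=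
    interior_maximal (Set.image_subset_iff.2 fun y hy => hS y (interior_subset hy)) hopen
  rw [interior_Iic] at hsub
  exact hsub ⟨z, hz, rfl⟩

end Interior

/-! ### The dual arrangement -/

section Arrangement

variable {K V ι : Type*} [Field K] [AddCommGroup V] [Module K V]

/-- The hyperplanes of the dual arrangement `{f | f (v i) = h i}`, `i : ι`, that pass through
`f`. -/
def contactSet (v : ι → V) (h : ι → K) (f : Module.Dual K V) : Set ι :=
  {i | f (v i) = h i}

/-- `f` is a vertex of the dual arrangement: it is the only point common to the hyperplanes that
pass through it. -/
def IsDualVertex (v : ι → V) (h : ι → K) (f : Module.Dual K V) : Prop :=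
  Submodule.span K (v '' contactSet v h f) = ⊤

/-- The dual arrangement is simple: the hyperplanes through each of its vertices are
independent. -/
def IsSimpleDual (v : ι → V) (h : ι → K) : Prop :=
  ∀ f, IsDualVertex v h f → LinearIndepOn K v (contactSet v h f)

/-- `X` lies on none of the hyperplanes spanned by all but one of the contacts `v i` of a vertex,
apart from those containing every other `v i`. The latter correspond to the edges of the dual
arrangement with a single vertex, that is, to the boundary facets of the tiling. -/
def IsDualGeneric (v : ι → V) (h : ι → K) (X : V) : Prop :=
  ∀ f, IsDualVertex v h f → ∀ b ∈ contactSet v h f,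
    X ∈ Submodule.span K (v '' (contactSet v h f \ {b})) →
      ∀ i, i ≠ b → v i ∈ Submodule.span K (v '' (contactSet v h f \ {b}))

variable {v : ι → V} {h : ι → K} {f g : Module.Dual K V}

lemma mem_contactSet {i : ι} : i ∈ contactSet v h f ↔ f (v i) = h i := Iff.rfl

lemma IsDualVertex.eq_of_eqOn (hf : IsDualVertex v h f)
    (hfg : ∀ i ∈ contactSet v h f, f (v i) = g (v i)) : f = g :=
  LinearMap.ext_on hf (Set.forall_mem_image.2 hfg)

lemma IsDualVertex.span_insert_contactSet_diff (hf : IsDualVertex v h f) {b : ι}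
    (hb : b ∈ contactSet v h f) :
    Submodule.span K (insert (v b) (v '' (contactSet v h f \ {b}))) = ⊤ := by
  rw [← Set.image_insert_eq, Set.insert_sdiff_self_of_mem hb, hf]

lemma exists_isDualVertex_contactSet_superset {s : Set ι} (hs : LinearIndepOn K v s)
    (htop : Submodule.span K (Set.range v) = ⊤) (h : ι → K) :
    ∃ f, IsDualVertex v h f ∧ s ⊆ contactSet v h f := by
  obtain ⟨B, -, hsB, hspan, hB⟩ := exists_linearIndepOn_extension hs (Set.subset_univ s)
  obtain ⟨f, hf⟩ := exists_dual_eqOn hB h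
  refine ⟨f, ?_, fun i hi => hf i (hsB hi)⟩
  rw [IsDualVertex, eq_top_iff, ← htop, ← Set.image_univ, Submodule.span_le]
  exact hspan.trans (Submodule.span_mono (Set.image_mono hf))

lemma contactSet_add_smul_eq_insert (hsimple : IsSimpleDual v h) (hf : IsDualVertex v h f)
    {N : Module.Dual K V} {b b' : ι} (hb : b ∈ contactSet v h f)
    (hN : ∀ i ∈ contactSet v h f \ {b}, N (v i) = 0) (hNb' : N (v b') ≠ 0) {s : K}
    (hs : h b' - f (v b') - s * N (v b') = 0) :
    IsDualVertex v h (f + s • N) ∧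
      contactSet v h (f + s • N) = insert b' (contactSet v h f \ {b}) := by
  have hsub : insert b' (contactSet v h f \ {b}) ⊆ contactSet v h (f + s • N) := by
    refine Set.insert_subset ?_ fun i hi => ?_
    · simp only [mem_contactSet, LinearMap.add_apply, LinearMap.smul_apply, smul_eq_mul]
      linear_combination -hs
    · simp only [mem_contactSet, LinearMap.add_apply, LinearMap.smul_apply, hN i hi, smul_zero,
        add_zero, mem_contactSet.1 hi.1]
  have htop : Submodule.span K (v '' insert b' (contactSet v h f \ {b})) = ⊤ := by
    rw [Set.image_insert_eq]
    exact span_insert_eq_top_of_dual (Set.forall_mem_image.2 hN) hNb'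
      (hf.span_insert_contactSet_diff hb)
  have hf' : IsDualVertex v h (f + s • N) :=
    top_unique (htop.symm.trans_le (Submodule.span_mono (Set.image_mono hsub)))
  exact ⟨hf', (eq_of_subset_of_span_eq_top (hsimple _ hf') hsub htop).symm⟩

end Arrangement

section Pivot

variable {K V ι : Type*} [Field K] [LinearOrder K] [AddCommGroup V] [Module K V]

/-- The vertices `f` and `f'` of the dual arrangement are joined by an edge: `f'` lies on `b'`
instead of `b`, and no other hyperplane separates the two. -/
structure IsPivot (v : ι → V) (h : ι → K) (f f' : Module.Dual K V) (b b' : ι) : Prop where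
  mem : b ∈ contactSet v h f
  notMem : b' ∉ contactSet v h f
  contactSet_eq : contactSet v h f' = insert b' (contactSet v h f \ {b})
  lt_iff : ∀ i, i ≠ b → i ≠ b' → (f' (v i) < h i ↔ f (v i) < h i)

variable [IsStrictOrderedRing K] {v : ι → V} {h : ι → K} {f : Module.Dual K V}

lemma exists_isPivot [Finite ι] (hsimple : IsSimpleDual v h) (hf : IsDualVertex v h f)
    {N : Module.Dual K V} {b : ι} (hb : b ∈ contactSet v h f)
    (hN : ∀ i ∈ contactSet v h f \ {b}, N (v i) = 0)
    (hi : ∃ i, 0 < (h i - f (v i)) * N (v i)) :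
    ∃ s : K, 0 < s ∧ ∃ b', IsDualVertex v h (f + s • N) ∧ IsPivot v h f (f + s • N) b b' ∧
      ∀ i, 0 ≤ (h i - f (v i)) * (h i - (f + s • N) (v i)) := by
  obtain ⟨s, hs, b', hNb', hb', hsb', hsign⟩ := exists_pos_sub_mul_eq_zero hi
  obtain ⟨hf', hcontact⟩ := contactSet_add_smul_eq_insert hsimple hf hb hN hNb' hsb'
  have hsign' (i : ι) : 0 ≤ (h i - f (v i)) * (h i - (f + s • N) (v i)) := by
    simpa only [LinearMap.add_apply, LinearMap.smul_apply, smul_eq_mul, sub_sub] using hsign i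
  refine ⟨s, hs, b', hf', ⟨hb, fun h => hb' (sub_eq_zero.2 h.symm), hcontact,
    fun i hib hib' => ?_⟩, hsign'⟩
  have hmem : i ∈ contactSet v h (f + s • N) ↔ i ∈ contactSet v h f := by
    simp [hcontact, hib, hib']
  rcases eq_or_ne (f (v i)) (h i) with hfi | hfi
  · rw [mem_contactSet.1 (hmem.2 hfi), hfi]
  · have hfi' : (f + s • N) (v i) ≠ h i := mt hmem.1 hfi
    have hpos := (hsign' i).lt_of_ne'
      (mul_ne_zero (sub_ne_zero.2 hfi.symm) (sub_ne_zero.2 hfi'.symm))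
    rw [← sub_pos, ← sub_pos (b := f (v i))]
    exact ⟨fun h' => pos_of_mul_pos_left hpos h'.le, fun h' => pos_of_mul_pos_right hpos h'.le⟩

end Pivot

section ConicCombination

variable {K V ι : Type*} [Field K] [LinearOrder K] [AddCommGroup V] [Module K V]
  [Fintype ι]

/-- The coefficients `μ` write `X` as a nonnegative combination of the `v i` with `i ∈ S`. -/
structure IsConicCombination (v : ι → V) (S : Set ι) (X : V) (μ : ι → K) : Prop where
  nonneg : ∀ i, 0 ≤ μ i
  eq_zero : ∀ i ∉ S, μ i = 0
  sum_eq : ∑ i, μ i • v i = X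

variable {v : ι → V} {h : ι → K} {f : Module.Dual K V} {X : V} {μ : ι → K}

lemma IsConicCombination.of_ne_zero {S S' : Set ι} (hμ : IsConicCombination v S X μ)
    (hS : ∀ i ∈ S, μ i ≠ 0 → i ∈ S') : IsConicCombination v S' X μ where
  nonneg := hμ.nonneg
  eq_zero i hi := by
    by_contra hμi
    exact hi (hS i (by_contra fun hiS => hμi (hμ.eq_zero i hiS)) hμi)
  sum_eq := hμ.sum_eq

lemma IsConicCombination.apply_eq {S : Set ι} (hμ : IsConicCombination v S X μ)
    (N : Module.Dual K V) : N X = ∑ i, μ i * N (v i) := by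
  simp only [← hμ.sum_eq, map_sum, map_smul, smul_eq_mul]

lemma IsConicCombination.mem_span {S : Set ι} (hμ : IsConicCombination v S X μ) :
    X ∈ Submodule.span K (v '' S) := by
  rw [← hμ.sum_eq]
  refine Submodule.sum_mem _ fun i _ => ?_
  by_cases hi : i ∈ S
  · exact Submodule.smul_mem _ _ (Submodule.subset_span (Set.mem_image_of_mem v hi))
  · rw [hμ.eq_zero i hi, zero_smul]
    exact Submodule.zero_mem _

end ConicCombination

section Ascent

variable {K V ι : Type*} [Field K] [LinearOrder K] [IsStrictOrderedRing K] [AddCommGroup V]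
  [Module K V] [Fintype ι]
variable {v : ι → V} {h : ι → K} {f : Module.Dual K V} {X : V} {μ : ι → K}

lemma exists_neg_of_sum_smul_eq_zero {e : Module.Dual K V} (he : ∀ i, 0 < e (v i)) {γ : ι → K}
    (hγ : γ ≠ 0) (hsum : ∑ i, γ i • v i = 0) : ∃ i, γ i < 0 := by
  by_contra! hnonneg
  have hsum' : ∑ i, γ i * e (v i) = 0 := by
    simpa only [map_sum, map_smul, smul_eq_mul, map_zero] using congrArg e hsum
  refine hγ (funext fun i => ?_)
  have hi := (Finset.sum_eq_zero_iff_of_nonneg fun j _ =>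
    mul_nonneg (hnonneg j) (he j).le).1 hsum' i (Finset.mem_univ i)
  exact (mul_eq_zero.1 hi).resolve_right (he i).ne'

-- Two different representations of `X` differ by `γ`. If there is only one, then `X` lies in the
-- cone over the contacts, in its interior by genericity, and can be moved towards any `v i`.
lemma exists_relation_of_isDualGeneric (hsimple : IsSimpleDual v h) (hf : IsDualVertex v h f)
    (hX : IsDualGeneric v h X) (hμ : IsConicCombination v {i | f (v i) ≤ h i} X μ)
    (hlt : ∃ i, f (v i) < h i) {l : ι → K} (hl : ∀ i ∉ contactSet v h f, l i = 0)
    (hlX : ∑ i, l i • v i = X) :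
    ∃ γ : ι → K, γ ≠ 0 ∧ ∑ i, γ i • v i = 0 ∧ (∀ i, h i < f (v i) → γ i = 0) ∧
      ∀ i, γ i < 0 → 0 < l i := by
  classical
  rcases ne_or_eq μ l with hne | rfl
  · refine ⟨μ - l, sub_ne_zero.2 hne, ?_, fun i hi => ?_, fun i hi => ?_⟩
    · simp only [Pi.sub_apply, sub_smul, Finset.sum_sub_distrib, hμ.sum_eq, hlX, sub_self]
    · rw [Pi.sub_apply, hμ.eq_zero i hi.not_ge, hl i hi.ne', sub_self]
    · exact (hμ.nonneg i).trans_lt (sub_neg.1 hi)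
  · obtain ⟨i, hi⟩ := hlt
    obtain ⟨g, hg, hgi⟩ := exists_coeff_of_mem_span_image (hf ▸ Submodule.mem_top : v i ∈ _)
    refine ⟨Pi.single i 1 - g, fun h₀ => ?_, ?_, fun j hj => ?_, fun b hb => ?_⟩
    · have := congrFun h₀ i
      rw [Pi.sub_apply, hg i hi.ne, Pi.single_eq_same, sub_zero] at this
      exact one_ne_zero this
    · simp [sub_smul, Finset.sum_sub_distrib, hgi, Pi.single_apply]
    · have hji : j ≠ i := by rintro rfl; exact hj.not_gt hi
      rw [Pi.sub_apply, hg j hj.ne', Pi.single_eq_of_ne hji, sub_zero]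
    · have hgb : 0 < g b := by
        have hnonneg : (0 : ι → K) ≤ Pi.single i 1 := Pi.single_nonneg.2 zero_le_one
        exact (hnonneg b).trans_lt (sub_neg.1 hb)
      have hb' : b ∈ contactSet v h f := by_contra fun hb' => hgb.ne' (hg b hb')
      refine (hμ.nonneg b).lt_of_ne' fun hμb => hgb.ne' ?_
      obtain ⟨N, hNb, hker⟩ := exists_dual_ker_eq_span_diff (hsimple f hf) hf hb'
      have hN : ∀ j ∈ contactSet v h f \ {b}, N (v j) = 0 := fun j hj =>
        hker.ge (Submodule.subset_span (Set.mem_image_of_mem v hj))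
      have hNX : N X = 0 := by rw [← hlX, dual_apply_sum_smul_eq hNb hN hl, hμb]
      have hib : i ≠ b := by rintro rfl; exact hi.ne hb'
      rw [← dual_apply_sum_smul_eq hNb hN hg, hgi]
      exact hker.ge (hX f hf b hb' (hker.le hNX) i hib)

lemma exists_contact_removable (hsimple : IsSimpleDual v h) (hf : IsDualVertex v h f)
    {e : Module.Dual K V} (he : ∀ i, 0 < e (v i)) (hX : IsDualGeneric v h X)
    (hμ : IsConicCombination v {i | f (v i) ≤ h i} X μ) (hlt : ∃ i, f (v i) < h i) :
    ∃ b ∈ contactSet v h f, ∃ N : Module.Dual K V, N (v b) = 1 ∧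
      (∀ i ∈ contactSet v h f \ {b}, N (v i) = 0) ∧ 0 < N X ∧
      ∃ ν : ι → K, IsConicCombination v {i | f (v i) ≤ h i} X ν ∧ ν b = 0 := by
  obtain ⟨l, hl, hlX⟩ := exists_coeff_of_mem_span_image (hf ▸ Submodule.mem_top : X ∈ _)
  obtain ⟨γ, hγ, hγsum, hγ₀, hγneg⟩ := exists_relation_of_isDualGeneric hsimple hf hX hμ hlt hl hlX
  obtain ⟨t, -, b, hγb, hb₀, hnonneg⟩ := exists_add_mul_eq_zero_of_nonneg hμ.nonneg
    (exists_neg_of_sum_smul_eq_zero he hγ hγsum)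
  have hlb : 0 < l b := hγneg b hγb
  have hb : b ∈ contactSet v h f := by_contra fun hb => hlb.ne' (hl b hb)
  obtain ⟨N, hNb, hker⟩ := exists_dual_ker_eq_span_diff (hsimple f hf) hf hb
  have hN : ∀ i ∈ contactSet v h f \ {b}, N (v i) = 0 := fun i hi =>
    hker.ge (Submodule.subset_span (Set.mem_image_of_mem v hi))
  refine ⟨b, hb, N, hNb, hN, ?_, fun i => μ i + t * γ i, ⟨hnonneg, fun i hi => ?_, ?_⟩, hb₀⟩
  · rwa [← hlX, dual_apply_sum_smul_eq hNb hN hl]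
  · rw [hμ.eq_zero i hi, hγ₀ i (not_le.1 hi), mul_zero, add_zero]
  · simp only [add_smul, mul_smul, Finset.sum_add_distrib, ← Finset.smul_sum, hμ.sum_eq, hγsum,
      smul_zero, add_zero]

lemma exists_ascending_pivot (hsimple : IsSimpleDual v h) (hf : IsDualVertex v h f)
    {e : Module.Dual K V} (he : ∀ i, 0 < e (v i)) (hX : IsDualGeneric v h X)
    (hμ : IsConicCombination v {i | f (v i) ≤ h i} X μ) (hlt : ∃ i, f (v i) < h i) :
    ∃ f' b b', IsDualVertex v h f' ∧ IsPivot v h f f' b b' ∧ f X < f' X ∧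
      (∃ ν : ι → K, IsConicCombination v {i | f' (v i) ≤ h i} X ν) ∧
      ∀ i, f' (v i) < h i → f (v i) < h i := by
  obtain ⟨b, hb, N, hNb, hN, hNX, ν, hν, hνb⟩ :=
    exists_contact_removable hsimple hf he hX hμ hlt
  have hcontact {i : ι} (hνi : ν i ≠ 0) (hi : i ∈ contactSet v h f) : N (v i) = 0 :=
    hN i ⟨hi, fun hib => hνi (hib ▸ hνb)⟩
  have hblocking : ∃ i, 0 < (h i - f (v i)) * N (v i) := by
    rw [hν.apply_eq N] at hNX
    obtain ⟨i, -, hi⟩ := Finset.exists_lt_of_sum_lt (by simpa using hNX :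
      ∑ i : ι, (0 : K) < ∑ i, ν i * N (v i))
    have hNi : 0 < N (v i) := pos_of_mul_pos_right hi (hν.nonneg i)
    have hνi : ν i ≠ 0 := left_ne_zero_of_mul hi.ne'
    have hfi : f (v i) ≤ h i := by_contra fun h' => hνi (hν.eq_zero i h')
    exact ⟨i, mul_pos (sub_pos.2 (hfi.lt_of_ne fun h' => hNi.ne' (hcontact hνi h'))) hNi⟩
  obtain ⟨s, hs, b', hf', hpivot, hsign⟩ := exists_isPivot hsimple hf hb hN hblocking
  refine ⟨f + s • N, b, b', hf', hpivot, ?_, ⟨ν, hν.of_ne_zero fun i hi hνi => ?_⟩,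
    fun i hi => ?_⟩
  · exact lt_add_of_pos_right _ (mul_pos hs hNX)
  · rcases (show f (v i) ≤ h i from hi).lt_or_eq with hi | hi
    · exact sub_nonneg.1 (nonneg_of_mul_nonneg_right (hsign i) (sub_pos.2 hi))
    · simp [hcontact hνi hi, hi]
  · have hfi : f (v i) ≤ h i :=
      sub_nonneg.1 (nonneg_of_mul_nonneg_left (hsign i) (sub_pos.2 hi))
    refine hfi.lt_of_ne fun hfi => hi.not_ge ?_
    have hNi : 0 ≤ N (v i) := by
      rcases eq_or_ne i b with rfl | hib
      · exact hNb ▸ zero_le_one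
      · exact (hN i ⟨hfi, hib⟩).ge
    simpa [hfi] using mul_nonneg hs.le hNi

end Ascent

section Uniqueness

variable {K V ι : Type*} [Field K] [LinearOrder K] [IsStrictOrderedRing K] [AddCommGroup V]
  [Module K V] [Fintype ι]
variable {v : ι → V} {h : ι → K} {f f' : Module.Dual K V} {X : V} {μ μ' : ι → K}

lemma IsConicCombination.mul_apply_le (hμ : IsConicCombination v {i | f (v i) ≤ h i} X μ)
    (hle' : ∀ i, h i ≤ f' (v i)) (i : ι) : μ i * f (v i) ≤ μ i * f' (v i) := by
  by_cases hi : f (v i) ≤ h i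
  · exact mul_le_mul_of_nonneg_left (hi.trans (hle' i)) (hμ.nonneg i)
  · rw [hμ.eq_zero i hi, zero_mul, zero_mul]

lemma IsConicCombination.apply_le (hμ : IsConicCombination v {i | f (v i) ≤ h i} X μ)
    (hle' : ∀ i, h i ≤ f' (v i)) : f X ≤ f' X := by
  rw [hμ.apply_eq f, hμ.apply_eq f']
  exact Finset.sum_le_sum fun i _ => hμ.mul_apply_le hle' i

lemma IsConicCombination.apply_eq_apply_of_ne_zero
    (hμ : IsConicCombination v {i | f (v i) ≤ h i} X μ) (hle' : ∀ i, h i ≤ f' (v i))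
    (hX : f X = f' X) {i : ι} (hi : μ i ≠ 0) : f (v i) = f' (v i) := by
  rw [hμ.apply_eq f, hμ.apply_eq f',
    Finset.sum_eq_sum_iff_of_le fun i _ => hμ.mul_apply_le hle' i] at hX
  exact mul_left_cancel₀ hi (hX i (Finset.mem_univ i))

-- Linear programming duality with complementary slackness: `f` and `f'` both minimize the value
-- at `X` subject to `h ≤ f ∘ v`, so only their common contacts occur in `μ`.
lemma IsDualVertex.eq_of_le (hsimple : IsSimpleDual v h) (hf : IsDualVertex v h f)
    (hf' : IsDualVertex v h f') (hle : ∀ i, h i ≤ f (v i)) (hle' : ∀ i, h i ≤ f' (v i))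
    (hX : IsDualGeneric v h X) (hμ : IsConicCombination v {i | f (v i) ≤ h i} X μ)
    (hμ' : IsConicCombination v {i | f' (v i) ≤ h i} X μ') : f = f' := by
  have hfX : f X = f' X := le_antisymm (hμ.apply_le hle') (hμ'.apply_le hle)
  refine hf.eq_of_eqOn fun b hb => by_contra fun hne => ?_
  have hXb : X ∈ Submodule.span K (v '' (contactSet v h f \ {b})) := by
    refine IsConicCombination.mem_span (hμ.of_ne_zero fun i hi hμi =>
      ⟨le_antisymm hi (hle i), fun hib => hne ?_⟩)
    obtain rfl : i = b := hib
    exact hμ.apply_eq_apply_of_ne_zero hle' hfX hμi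
  have htop : Submodule.span K (v '' (contactSet v h f \ {b})) = ⊤ := by
    rw [eq_top_iff, ← hf', Submodule.span_le]
    rintro _ ⟨i, hi, rfl⟩
    refine hX f hf b hb hXb i ?_
    rintro rfl
    exact hne ((mem_contactSet.1 hb).trans (mem_contactSet.1 hi).symm)
  have hdiff := eq_of_subset_of_span_eq_top (hsimple f hf) Set.sdiff_subset htop
  exact (hdiff.ge hb).2 rfl

end Uniqueness

/-! ### Cells and sign vectors -/

attribute [ext] Cell

section Cells

variable {n : ℕ}

/-- The cell on which the coefficient of a direction is `1`, free or `0` according to whether the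
entry of the sign vector `w` is positive, zero or negative. -/
noncomputable def Cell.ofSign (w : Fin n → ℝ) : Cell n where
  base := {i | 0 < w i}
  dirs := {i | w i = 0}
  disj := Finset.disjoint_filter.2 fun _ _ hi => hi.ne'

/-- The coefficient vectors of the points of `Π_{I,B}`. -/
def Cell.weights (T : Cell n) : Set (Fin n → ℝ) :=
  {α | (∀ i, 0 ≤ α i ∧ α i ≤ 1) ∧ (∀ i ∈ T.base, α i = 1) ∧ ∀ i ∉ T.base ∪ T.dirs, α i = 0}

lemma Cell.toSet_eq_image_weights {m : ℕ} (T : Cell n) (v : Fin n → Fin m → ℝ) :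
    T.toSet v = (fun α => ∑ i, α i • v i) '' T.weights := by
  have hsum {α : Fin n → ℝ} (hbase : ∀ i ∈ T.base, α i = 1)
      (hoff : ∀ i ∉ T.base ∪ T.dirs, α i = 0) :
      ∑ i, α i • v i = ∑ i ∈ T.base, v i + ∑ b ∈ T.dirs, α b • v b := by
    rw [← Finset.sum_subset (Finset.subset_univ (T.base ∪ T.dirs))
      fun i _ hi => by rw [hoff i hi, zero_smul], Finset.sum_union T.disj]
    exact congrArg (· + _) (Finset.sum_congr rfl fun i hi => by rw [hbase i hi, one_smul])
  refine Set.Subset.antisymm ?_ ?_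
  · rintro _ ⟨α, hα, rfl⟩
    have hdirs {b : Fin n} (hb : b ∈ T.dirs) : b ∉ T.base := Finset.disjoint_right.1 T.disj hb
    let β : Fin n → ℝ := fun i => if i ∈ T.base then 1 else if i ∈ T.dirs then α i else 0
    have hβ : β ∈ T.weights := by
      refine ⟨fun i => ?_, fun i hi => if_pos hi, fun i hi => ?_⟩
      · by_cases hi : i ∈ T.base
        · simp [β, hi]
        · by_cases hi' : i ∈ T.dirs
          · simp [β, hi, hi', hα i hi']
          · simp [β, hi, hi']
      · simp only [Finset.mem_union, not_or] at hi
        simp [β, hi.1, hi.2]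
    refine ⟨β, hβ, (hsum hβ.2.1 hβ.2.2).trans (congrArg _ (Finset.sum_congr rfl fun b hb => ?_))⟩
    simp [β, hdirs hb, hb]
  · rintro _ ⟨α, ⟨hα, hbase, hoff⟩, rfl⟩
    exact ⟨α, fun b _ => hα b, hsum hbase hoff⟩

lemma Cell.mem_weights_ofSign {w α : Fin n → ℝ} :
    α ∈ (Cell.ofSign w).weights ↔ (∀ i, 0 ≤ α i ∧ α i ≤ 1) ∧ ∀ i, α i * w i = max (w i) 0 := by
  simp only [Cell.weights, Cell.ofSign, Set.mem_ofPred_eq, Finset.mem_union, Finset.mem_filter,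
    Finset.mem_univ, true_and, ← forall_and]
  refine forall_congr' fun i => and_congr_right fun _ => ?_
  rcases lt_trichotomy (w i) 0 with hw | hw | hw
  · simp [hw.le, hw.not_gt, hw.ne]
  · simp [hw]
  · simp [hw.le, hw, hw.ne']

lemma Cell.indicator_mem_weights {T : Cell n} {S : Finset (Fin n)} (hS : T.base ⊆ S)
    (hS' : S ⊆ T.base ∪ T.dirs) : (S : Set (Fin n)).indicator 1 ∈ T.weights := by
  refine ⟨fun i => ?_, fun i hi => ?_, fun i hi => ?_⟩
  · by_cases hi : i ∈ S <;> simp [hi]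
  · simp [hS hi]
  · simp [mt (@hS' i) hi]

lemma Cell.eq_zero_of_weights_subset {T : Cell n} {w : Fin n → ℝ}
    (hT : T.weights ⊆ (Cell.ofSign w).weights) {b : Fin n} (hb : b ∈ T.dirs) : w b = 0 := by
  have h₀ := (Cell.mem_weights_ofSign.1 (hT (Cell.indicator_mem_weights
    (Finset.Subset.refl T.base) Finset.subset_union_left))).2 b
  have h₁ := (Cell.mem_weights_ofSign.1 (hT (Cell.indicator_mem_weights
    (Finset.subset_insert b T.base) (Finset.insert_subset (Finset.mem_union_right _ hb)
      Finset.subset_union_left)))).2 b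
  have hb' : b ∉ T.base := Finset.disjoint_right.1 T.disj hb
  rw [Set.indicator_of_notMem (by simpa using hb'), zero_mul] at h₀
  rw [Set.indicator_of_mem (by simp), Pi.one_apply, one_mul] at h₁
  exact h₁.trans h₀.symm

lemma Cell.eq_ofSign_of_weights_subset {T : Cell n} {w : Fin n → ℝ}
    (hT : T.weights ⊆ (Cell.ofSign w).weights) (hw : ∀ i, w i = 0 → i ∈ T.dirs) :
    T = Cell.ofSign w := by
  have hdirs (i : Fin n) : i ∈ T.dirs ↔ w i = 0 := ⟨Cell.eq_zero_of_weights_subset hT, hw i⟩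
  have hbase := (Cell.mem_weights_ofSign.1 (hT (Cell.indicator_mem_weights
    (Finset.Subset.refl T.base) Finset.subset_union_left))).2
  ext i
  · by_cases hi : i ∈ T.base
    · have hwi : w i ≠ 0 := mt (hdirs i).2 (Finset.disjoint_left.1 T.disj hi)
      have hwi' : 0 ≤ w i := by simpa [hi] using hbase i
      simpa [Cell.ofSign, hi] using hwi'.lt_of_ne' hwi
    · have hwi : w i ≤ 0 := by simpa [hi] using hbase i
      simpa [Cell.ofSign, hi] using hwi
  · simp [Cell.ofSign, hdirs]

lemma zonotope_face_iff {m : ℕ} (u : Fin n → Fin m → ℝ) (y : Fin m → ℝ) {α : Fin n → ℝ}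
    (hα : ∀ i, 0 ≤ α i ∧ α i ≤ 1) :
    (∀ z ∈ zonotope u, z ⬝ᵥ y ≤ (∑ i, α i • u i) ⬝ᵥ y) ↔
      α ∈ (Cell.ofSign fun i => u i ⬝ᵥ y).weights := by
  have hle {β : Fin n → ℝ} (hβ : ∀ i, 0 ≤ β i ∧ β i ≤ 1) (i : Fin n) :
      β i * (u i ⬝ᵥ y) ≤ max (u i ⬝ᵥ y) 0 := mul_le_max_zero (hβ i)
  rw [Cell.mem_weights_ofSign, sum_smul_dotProduct]
  refine ⟨fun hmax => ⟨hα, fun i => ?_⟩, ?_⟩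
  · obtain ⟨hβ, hβw⟩ := Cell.mem_weights_ofSign.1 (Cell.indicator_mem_weights
      (T := Cell.ofSign fun i => u i ⬝ᵥ y) (Finset.Subset.refl _) Finset.subset_union_left)
    have hβmax := hmax _ ⟨_, hβ, rfl⟩
    rw [sum_smul_dotProduct, Finset.sum_congr rfl fun i _ => hβw i] at hβmax
    exact (Finset.sum_eq_sum_iff_of_le fun i _ => hle hα i).1
      ((Finset.sum_le_sum fun i _ => hle hα i).antisymm hβmax) i (Finset.mem_univ i)
  · rintro ⟨-, hαw⟩ _ ⟨β, hβ, rfl⟩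
    rw [sum_smul_dotProduct, Finset.sum_congr rfl fun i _ => hαw i]
    exact Finset.sum_le_sum fun i _ => hle hβ i

lemma zonotope_face_eq_toSet {m : ℕ} (u : Fin n → Fin m → ℝ) (y : Fin m → ℝ) :
    {z | z ∈ zonotope u ∧ ∀ z' ∈ zonotope u, z' ⬝ᵥ y ≤ z ⬝ᵥ y} =
      (Cell.ofSign fun i => u i ⬝ᵥ y).toSet u := by
  rw [Cell.toSet_eq_image_weights]
  refine Set.Subset.antisymm ?_ ?_
  · rintro _ ⟨⟨α, hα, rfl⟩, hmax⟩
    exact ⟨α, (zonotope_face_iff u y hα).1 hmax, rfl⟩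
  · rintro _ ⟨α, hα, rfl⟩
    exact ⟨⟨α, hα.1, rfl⟩, (zonotope_face_iff u y hα.1).2 hα⟩

lemma Cell.weights_subset_of_toSet_eq_face {m : ℕ} {T : Cell n} {u : Fin n → Fin m → ℝ}
    {y : Fin m → ℝ}
    (hT : T.toSet u = {z | z ∈ zonotope u ∧ ∀ z' ∈ zonotope u, z' ⬝ᵥ y ≤ z ⬝ᵥ y}) :
    T.weights ⊆ (Cell.ofSign fun i => u i ⬝ᵥ y).weights := by
  intro α hα
  rw [Cell.toSet_eq_image_weights] at hT
  exact (zonotope_face_iff u y hα.1).1 (hT.le (Set.mem_image_of_mem _ hα)).2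

instance : Finite (Cell n) :=
  Finite.of_injective (fun T : Cell n => (T.base, T.dirs)) fun _ _ hTT' =>
    Cell.ext (congrArg Prod.fst hTT') (congrArg Prod.snd hTT')

end Cells

section Cut

variable {n : ℕ} {V : Type*} [AddCommGroup V] [Module ℝ V]

/-- The cell corresponding to the vertex `f` of the dual arrangement: its directions are the
contacts of `f`, and its base consists of the heights above `f`. -/
noncomputable def Cell.cut (v : Fin n → V) (h : Fin n → ℝ) (f : Module.Dual ℝ V) : Cell n :=
  Cell.ofSign fun i => h i - f (v i)

variable {v : Fin n → V} {h : Fin n → ℝ} {f f' : Module.Dual ℝ V}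

lemma Cell.mem_base_cut {i : Fin n} : i ∈ (Cell.cut v h f).base ↔ f (v i) < h i := by
  simp [Cell.cut, Cell.ofSign]

lemma Cell.mem_dirs_cut {i : Fin n} : i ∈ (Cell.cut v h f).dirs ↔ i ∈ contactSet v h f := by
  simp [Cell.cut, Cell.ofSign, mem_contactSet, sub_eq_zero, eq_comm (a := f (v i))]

lemma Cell.coe_dirs_cut : ((Cell.cut v h f).dirs : Set (Fin n)) = contactSet v h f :=
  Set.ext fun _ => Cell.mem_dirs_cut

lemma Cell.coe_base_union_dirs_cut :
    (((Cell.cut v h f).base ∪ (Cell.cut v h f).dirs : Finset (Fin n)) : Set (Fin n)) =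
      {i | f (v i) ≤ h i} := by
  ext i
  simp [Cell.mem_base_cut, Cell.mem_dirs_cut, mem_contactSet, le_iff_lt_or_eq]

lemma Cell.order_cut_eq_zero_iff : (Cell.cut v h f).order = 0 ↔ ∀ i, h i ≤ f (v i) := by
  simp [Cell.order, Finset.eq_empty_iff_forall_notMem, Cell.mem_base_cut]

lemma Cell.order_cut_le_order_cut (hff' : ∀ i, f' (v i) < h i → f (v i) < h i) :
    (Cell.cut v h f').order ≤ (Cell.cut v h f).order :=
  Finset.card_le_card fun i hi => Cell.mem_base_cut.2 (hff' i (Cell.mem_base_cut.1 hi))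

lemma Cell.injOn_cut (v : Fin n → V) (h : Fin n → ℝ) :
    Set.InjOn (Cell.cut v h) {f | IsDualVertex v h f} := by
  refine fun f hf f' _ hff' => IsDualVertex.eq_of_eqOn hf fun i hi => ?_
  have hi' : i ∈ contactSet v h f' := Cell.mem_dirs_cut.1 (hff' ▸ Cell.mem_dirs_cut.2 hi)
  exact (mem_contactSet.1 hi).trans (mem_contactSet.1 hi').symm

lemma IsPivot.ne {b b' : Fin n} (hp : IsPivot v h f f' b b') : b ≠ b' :=
  fun hbb' => hp.notMem (hbb' ▸ hp.mem)

lemma IsPivot.symm {b b' : Fin n} (hp : IsPivot v h f f' b b') : IsPivot v h f' f b' b where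
  mem := hp.contactSet_eq ▸ Set.mem_insert b' _
  notMem := by simp [hp.contactSet_eq, hp.ne]
  contactSet_eq := by
    rw [hp.contactSet_eq, Set.insert_sdiff_self_of_notMem fun h => hp.notMem h.1,
      Set.insert_sdiff_self_of_mem hp.mem]
  lt_iff i hib' hib := (hp.lt_iff i hib hib').symm

lemma IsPivot.dirs_erase_eq {b b' : Fin n} (hp : IsPivot v h f f' b b') :
    (Cell.cut v h f').dirs.erase b' = (Cell.cut v h f).dirs.erase b := by
  rw [← Finset.coe_inj]
  simp only [Finset.coe_erase, Cell.coe_dirs_cut]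
  rw [hp.contactSet_eq, Set.insert_sdiff_self_of_notMem fun h => hp.notMem h.1]

lemma IsPivot.isFacetOf {b b' : Fin n} (hp : IsPivot v h f f' b b') {F : Cell n}
    (hdirs : F.dirs = (Cell.cut v h f).dirs.erase b)
    (hbase : F.base = (Cell.cut v h f).base ∪ (Cell.cut v h f').base) :
    F.IsFacetOf (Cell.cut v h f) := by
  have hsub {i : Fin n} (hi : i ∈ (Cell.cut v h f').base) (hib : i ≠ b) :
      i ∈ (Cell.cut v h f).base := by
    have hib' : i ≠ b' := by
      rintro rfl
      exact (Cell.mem_base_cut.1 hi).ne hp.symm.mem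
    exact Cell.mem_base_cut.2 ((hp.lt_iff i hib hib').1 (Cell.mem_base_cut.1 hi))
  refine ⟨b, Cell.mem_dirs_cut.2 hp.mem, hdirs, ?_⟩
  rw [hbase]
  by_cases hb : b ∈ (Cell.cut v h f').base
  · refine Or.inr (Finset.ext fun i => ?_)
    rcases eq_or_ne i b with rfl | hib
    · simp [hb]
    · simpa [hib] using fun hi => hsub hi hib
  · refine Or.inl (Finset.union_eq_left.2 fun i hi => hsub hi ?_)
    rintro rfl
    exact hb hi

lemma IsPivot.exists_isSharedFacet {b b' : Fin n} (hp : IsPivot v h f f' b b') {P : Set (Cell n)}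
    (hf : Cell.cut v h f ∈ P) (hf' : Cell.cut v h f' ∈ P) :
    ∃ F : Cell n, (F.dirs : Set (Fin n)) = contactSet v h f \ {b} ∧
      IsSharedFacet P F (Cell.cut v h f) (Cell.cut v h f') := by
  let F : Cell n :=
    { base := (Cell.cut v h f).base ∪ (Cell.cut v h f').base
      dirs := (Cell.cut v h f).dirs.erase b
      disj := Finset.disjoint_union_left.2
        ⟨(Cell.cut v h f).disj.mono_right (Finset.erase_subset _ _),
          hp.dirs_erase_eq ▸ (Cell.cut v h f').disj.mono_right (Finset.erase_subset _ _)⟩ }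
  have hne : Cell.cut v h f ≠ Cell.cut v h f' := fun heq =>
    hp.symm.notMem (Cell.mem_dirs_cut.1 (heq ▸ Cell.mem_dirs_cut.2 hp.mem))
  refine ⟨F, ?_, hf, hf', hne, hp.isFacetOf rfl rfl,
    hp.symm.isFacetOf hp.dirs_erase_eq.symm (Finset.union_comm _ _)⟩
  rw [Finset.coe_erase, Cell.coe_dirs_cut]

-- Both summands of each term of the difference are nonnegative: `α` maximizes `α i * w i` on the
-- first cell and `α'` maximizes `α' i * w' i` on the second one.
lemma Cell.sub_apply_le_of_mem_cut {m : ℕ} {v : Fin n → Fin m → ℝ}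
    {f f' : Module.Dual ℝ (Fin m → ℝ)} {z z' : Fin m → ℝ}
    (hz : z ∈ (Cell.cut v h f).toSet v) (hz' : z' ∈ (Cell.cut v h f').toSet v) :
    (f' - f) z' ≤ (f' - f) z := by
  rw [Cell.toSet_eq_image_weights] at hz hz'
  obtain ⟨α, hα, rfl⟩ := hz
  obtain ⟨α', hα', rfl⟩ := hz'
  obtain ⟨hα, hαw⟩ := Cell.mem_weights_ofSign.1 hα
  obtain ⟨hα', hαw'⟩ := Cell.mem_weights_ofSign.1 hα'
  simp only [map_sum, map_smul, smul_eq_mul]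
  refine Finset.sum_le_sum fun i _ => ?_
  have hle := (mul_le_max_zero (w := h i - f (v i)) (hα' i)).trans_eq (hαw i).symm
  have hle' := (mul_le_max_zero (w := h i - f' (v i)) (hα i)).trans_eq (hαw' i).symm
  rw [LinearMap.sub_apply]
  linarith

lemma Cell.sub_apply_lt_of_mem_interior_cut {m : ℕ} {v : Fin n → Fin m → ℝ}
    {f f' : Module.Dual ℝ (Fin m → ℝ)} (hff' : f' - f ≠ 0) {z z' : Fin m → ℝ}
    (hz : z ∈ (Cell.cut v h f).toSet v) (hz' : z' ∈ interior ((Cell.cut v h f').toSet v)) :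
    (f' - f) z' < (f' - f) z :=
  dual_apply_lt_of_mem_interior (D := LinearMap.toContinuousLinearMap (f' - f))
    (LinearMap.toContinuousLinearMap.map_ne_zero_iff.2 hff')
    (fun _ hy => Cell.sub_apply_le_of_mem_cut hz hy) hz'

end Cut

/-! ### Homogenization -/

section ProjLift

variable {ι : Type*} {m : ℕ}

@[simp]
lemma projLift_castSucc (p : Fin m → ℝ) (k : Fin m) : projLift p k.castSucc = p k := by
  simp [projLift]

@[simp]
lemma projLift_last (p : Fin m → ℝ) : projLift p (Fin.last m) = 1 := by
  simp [projLift]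

lemma sum_smul_projLift_eq_zero (s : Finset ι) (w : ι → ℝ) (p : ι → Fin m → ℝ) :
    ∑ i ∈ s, w i • projLift (p i) = 0 ↔ ∑ i ∈ s, w i = 0 ∧ ∑ i ∈ s, w i • p i = 0 := by
  rw [funext_iff, Fin.forall_fin_succ', and_comm]
  exact and_congr (by simp) (by simp [funext_iff])

lemma sum_smul_projLift_eq_projLift (s : Finset ι) (w : ι → ℝ) (p : ι → Fin m → ℝ)
    (q : Fin m → ℝ) :
    ∑ i ∈ s, w i • projLift (p i) = projLift q ↔ ∑ i ∈ s, w i = 1 ∧ ∑ i ∈ s, w i • p i = q := by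
  rw [funext_iff, Fin.forall_fin_succ', and_comm]
  exact and_congr (by simp) (by simp [funext_iff])

lemma affineIndependent_iff_linearIndependent_projLift (p : ι → Fin m → ℝ) :
    AffineIndependent ℝ p ↔ LinearIndependent ℝ fun i => projLift (p i) := by
  rw [affineIndependent_iff, linearIndependent_iff']
  refine forall₂_congr fun s w => ?_
  rw [sum_smul_projLift_eq_zero]
  tauto

lemma affineIndependent_iff_linearIndepOn_projLift (p : ι → Fin m → ℝ) (s : Finset ι) :
    AffineIndependent ℝ (fun i : s => p i) ↔
      LinearIndepOn ℝ (fun i => projLift (p i)) (s : Set ι) :=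
  affineIndependent_iff_linearIndependent_projLift _

lemma projLift_mem_span_image_iff {p : ι → Fin m → ℝ} {s : Set ι} {x : Fin m → ℝ} :
    projLift x ∈ Submodule.span ℝ ((fun i => projLift (p i)) '' s) ↔
      x ∈ affineSpan ℝ (p '' s) := by
  constructor
  · intro hx
    rw [Set.image_eq_range] at hx ⊢
    obtain ⟨c, hc⟩ := Finsupp.mem_span_range_iff_exists_finsupp.1 hx
    obtain ⟨hc₁, hcx⟩ := (sum_smul_projLift_eq_projLift c.support c (fun i : s => p i) x).1 hc
    rw [← hcx, ← Finset.affineCombination_eq_linear_combination _ _ _ hc₁]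
    exact affineCombination_mem_affineSpan hc₁ _
  · intro hx
    refine affineSpan_induction hx ?_ fun c u v w hu hv hw => ?_
    · rintro _ ⟨i, hi, rfl⟩
      exact Submodule.subset_span ⟨i, hi, rfl⟩
    · have hlift : projLift (c • (u -ᵥ v) +ᵥ w) =
          c • (projLift u - projLift v) + projLift w := by
        ext k
        induction k using Fin.lastCases <;> simp
      rw [hlift]
      exact add_mem (Submodule.smul_mem _ _ (sub_mem hu hv)) hw

lemma span_range_projLift_eq_top {p : ι → Fin m → ℝ} (hp : affineSpan ℝ (Set.range p) = ⊤) :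
    Submodule.span ℝ (Set.range fun i => projLift (p i)) = ⊤ := by
  have hmem (x : Fin m → ℝ) :
      projLift x ∈ Submodule.span ℝ (Set.range fun i => projLift (p i)) := by
    rw [← Set.image_univ, projLift_mem_span_image_iff, Set.image_univ, hp]
    exact AffineSubspace.mem_top ℝ _ x
  refine Submodule.eq_top_iff'.2 fun u => ?_
  have hu : u = projLift (fun k => u k.castSucc) + (u (Fin.last m) - 1) • projLift 0 := by
    ext k
    induction k using Fin.lastCases <;> simp
  rw [hu]
  exact add_mem (hmem _) (Submodule.smul_mem _ _ (hmem _))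

lemma mem_convexHull_image_iff_exists_isConicCombination [Fintype ι] {p : ι → Fin m → ℝ}
    {s : Set ι} {x : Fin m → ℝ} :
    x ∈ convexHull ℝ (p '' s) ↔
      ∃ μ : ι → ℝ, IsConicCombination (fun i => projLift (p i)) s (projLift x) μ := by
  classical
  constructor
  · intro hx
    obtain ⟨κ, _, w, z, hw, hw₁, hz, hwz⟩ := mem_convexHull_iff_exists_fintype.1 hx
    choose g hgs hgz using hz
    refine ⟨fun i => ∑ k with g k = i, w k, fun i => Finset.sum_nonneg fun k _ => hw k,
      fun i hi => ?_, ?_⟩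
    · exact Finset.sum_eq_zero fun k hk => absurd ((Finset.mem_filter.1 hk).2 ▸ hgs k) hi
    · rw [← (sum_smul_projLift_eq_projLift _ w z x).2 ⟨hw₁, hwz⟩]
      simp only [Finset.sum_smul, Finset.sum_filter, ite_smul, zero_smul]
      rw [Finset.sum_comm]
      simp [hgz]
  · rintro ⟨μ, hμ⟩
    have hs : ∀ i, i ∉ s.toFinset → μ i = 0 := fun i hi => hμ.eq_zero i (by simpa using hi)
    have hsum := hμ.sum_eq
    rw [← Finset.sum_subset (Finset.subset_univ s.toFinset) fun i _ hi => by simp [hs i hi],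
      sum_smul_projLift_eq_projLift] at hsum
    rw [← hsum.2]
    exact (convex_convexHull ℝ _).sum_mem (fun i _ => hμ.nonneg i) hsum.1
      fun i hi => subset_convexHull ℝ _ ⟨i, Set.mem_toFinset.1 hi, rfl⟩

lemma exists_linearIndepOn_projLift_of_mem_convexHull {p : ι → Fin m → ℝ}
    {x : Fin m → ℝ} (hx : x ∈ convexHull ℝ (Set.range p)) :
    ∃ J : Set ι, LinearIndepOn ℝ (fun i => projLift (p i)) J ∧ x ∈ convexHull ℝ (p '' J) := by
  rw [convexHull_eq_union] at hx
  simp only [Set.mem_iUnion] at hx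
  obtain ⟨t, htp, ht, hxt⟩ := hx
  choose g hg using fun y : t => htp y.2
  have hg' : p ∘ g = Subtype.val := funext hg
  refine ⟨Set.range g, ?_, ?_⟩
  · rw [linearIndepOn_range_iff (Function.Injective.of_comp (hg' ▸ Subtype.val_injective))]
    have ht' := (affineIndependent_iff_linearIndependent_projLift _).1 ht
    simpa only [Function.comp_def, hg] using ht'
  · rwa [← Set.range_comp, hg', Subtype.range_coe]

lemma Cell.supportedOn_cut_iff {n : ℕ} {a : Fin n → Fin m → ℝ} {h : Fin n → ℝ}
    {f : Module.Dual ℝ (Fin (m + 1) → ℝ)} {x : Fin m → ℝ} :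
    (Cell.cut (fun i => projLift (a i)) h f).SupportedOn a x ↔
      ∃ μ : Fin n → ℝ, IsConicCombination (fun i => projLift (a i)) {i | f (projLift (a i)) ≤ h i}
        (projLift x) μ := by
  rw [Cell.SupportedOn, Cell.coe_base_union_dirs_cut,
    mem_convexHull_image_iff_exists_isConicCombination]

end ProjLift

/-! ### Directed paths -/

section DirectedPaths

variable {α β γ : Type*} {G : Digraph α} {s t u : α} {p : List α}

lemma isDirectedPath_singleton : IsDirectedPath G t t [t] :=
  ⟨List.isChain_singleton t, List.nodup_singleton t, rfl, rfl⟩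

lemma IsDirectedPath.concat (hp : IsDirectedPath G s t p) (htu : G.Adj t u) (hu : u ∉ p) :
    IsDirectedPath G s u (p ++ [u]) := by
  obtain ⟨hchain, hnodup, hhead, hlast⟩ := hp
  refine ⟨List.isChain_append.2 ⟨hchain, List.isChain_singleton u, ?_⟩, ?_, ?_, by simp⟩
  · simpa [hlast] using htu
  · exact List.nodup_append'.2 ⟨hnodup, List.nodup_singleton u, by simpa using hu⟩
  · simp [hhead]

lemma exists_isDirectedPath_of_ascent [Finite α] [Preorder β] [Preorder γ] {P Z : α → Prop}
    {φ : α → β} {ord : α → γ}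
    (hstep : ∀ t, P t → ¬Z t → ∃ s, P s ∧ G.Adj s t ∧ φ t < φ s ∧ ord s ≤ ord t) (ht : P t) :
    ∃ s p, (P s ∧ Z s) ∧ IsDirectedPath G s t p ∧
      ∀ u ∈ p, P u ∧ φ t ≤ φ u ∧ ord u ≤ ord t := by
  have hwf : WellFounded fun s t => φ t < φ s :=
    @Finite.wellFounded_of_trans_of_irrefl _ _ _ ⟨fun _ _ _ h₁ h₂ => h₂.trans h₁⟩
      ⟨fun _ => lt_irrefl _⟩
  induction t using hwf.induction with
  | _ t ih =>
    by_cases hZ : Z t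
    · exact ⟨t, [t], ⟨ht, hZ⟩, isDirectedPath_singleton, by simp [ht]⟩
    · obtain ⟨t', ht', hadj, hlt, hord⟩ := hstep t ht hZ
      obtain ⟨s, p, hs, hp, hall⟩ := ih t' hlt ht'
      have htp : t ∉ p := fun h => (hall t h).2.1.not_gt hlt
      refine ⟨s, p ++ [t], hs, hp.concat hadj htp, ?_⟩
      simp only [List.forall_mem_append, List.forall_mem_singleton]
      exact ⟨fun u hu => ⟨(hall u hu).1, hlt.le.trans (hall u hu).2.1, (hall u hu).2.2.trans hord⟩,
        ht, le_rfl, le_rfl⟩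

end DirectedPaths

/-! ### Regular tilings -/

section Tiling

variable {n d : ℕ} {a : Fin n → Fin d → ℝ} {h : Fin n → ℝ} {x : Fin d → ℝ}

/-- The vectors `v_i = (a_i, 1)`. -/
local notation "𝐯" => fun i => projLift (a i)

variable (a h) in
lemma exists_upperNormal_of_dual (f : Module.Dual ℝ (Fin (d + 1) → ℝ)) :
    ∃ y : Fin (d + 2) → ℝ, y (Fin.last d).castSucc = 1 ∧
      ∀ i, projLift (heightLift a h i) ⬝ᵥ y = h i - f (projLift (a i)) := by
  obtain ⟨c, rfl⟩ := (dotProductEquiv ℝ (Fin (d + 1))).surjective f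
  refine ⟨Fin.snoc (α := fun _ => ℝ)
    (Fin.snoc (α := fun _ => ℝ) (fun k => -c k.castSucc) 1) (-c (Fin.last d)), by simp, fun i => ?_⟩
  simp only [dotProductEquiv_apply_apply, dotProduct, heightLift, projLift,
    Fin.sum_univ_castSucc, Fin.snoc_castSucc, Fin.snoc_last, mul_neg, mul_comm (c _),
    Finset.sum_neg_distrib]
  ring

variable (a h) in
lemma exists_dual_of_upperNormal {y : Fin (d + 2) → ℝ} (hy : y (Fin.last d).castSucc ≠ 0) :
    ∃ f : Module.Dual ℝ (Fin (d + 1) → ℝ), ∀ i, projLift (heightLift a h i) ⬝ᵥ y =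
      y (Fin.last d).castSucc * (h i - f (projLift (a i))) := by
  let c : Fin (d + 1) → ℝ :=
    Fin.snoc (α := fun _ => ℝ) (fun k => y k.castSucc.castSucc) (y (Fin.last (d + 1)))
  refine ⟨dotProductEquiv ℝ _ (-(y (Fin.last d).castSucc)⁻¹ • c), fun i => ?_⟩
  rw [dotProductEquiv_apply_apply, smul_dotProduct, smul_eq_mul, mul_sub, ← mul_assoc, mul_neg,
    mul_inv_cancel₀ hy]
  simp only [c, dotProduct, heightLift, projLift, Fin.sum_univ_castSucc, Fin.snoc_castSucc,
    Fin.snoc_last, mul_comm (y _)]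
  ring

lemma not_affineIndependent_heightLift {f : Module.Dual ℝ (Fin (d + 1) → ℝ)}
    {S : Finset (Fin n)} (hcard : S.card = d + 2) (hS : (S : Set (Fin n)) ⊆ contactSet 𝐯 h f) :
    ¬AffineIndependent ℝ (fun i : S => heightLift a h i) := by
  rw [affineIndependent_iff_linearIndepOn_projLift]
  intro hind
  obtain ⟨y, hy, hyf⟩ := exists_upperNormal_of_dual a h f
  have hy₀ : y = 0 := eq_zero_of_forall_dotProduct_eq_zero
    ((span_image_eq_top_iff_card_eq_finrank hind).2 (by simpa using hcard))
    fun i hi => by rw [hyf, sub_eq_zero]; exact (hS hi).symm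
  simp [hy₀] at hy

lemma eq_zero_of_dotProduct_heightLift_eq {S : Set (Fin n)}
    (hS : Submodule.span ℝ (𝐯 '' S) = ⊤) {N : Fin (d + 1) → ℝ}
    (hN : N (Fin.last d) = 0) {c : ℝ} (hc : ∀ i ∈ S, N ⬝ᵥ heightLift a h i = c) : N = 0 := by
  have hNc : (Fin.snoc (α := fun _ => ℝ) (fun k => N k.castSucc) (-c) : Fin (d + 1) → ℝ) = 0 :=
    eq_zero_of_forall_dotProduct_eq_zero hS fun i hi => by
      rw [dotProduct_comm, ← sub_eq_zero.2 (hc i hi)]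
      simp [dotProduct, Fin.sum_univ_castSucc, heightLift, hN, sub_eq_add_neg]
  ext k
  induction k using Fin.lastCases with
  | last => exact hN
  | cast k => simpa using congrFun hNc k.castSucc

lemma IsGenericHeight.isSimpleDual (hh : IsGenericHeight a h) : IsSimpleDual 𝐯 h := by
  classical
  intro f hf
  obtain ⟨B, hBf, -, hspan, hB⟩ := exists_linearIndepOn_extension
    (linearIndepOn_empty ℝ 𝐯) (Set.empty_subset (contactSet 𝐯 h f))
  have htop : Submodule.span ℝ (𝐯 '' B) = ⊤ :=
    top_unique (hf.symm.trans_le (Submodule.span_le.2 hspan))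
  suffices hfB : contactSet 𝐯 h f ⊆ B from hB.mono hfB
  intro i hi
  by_contra hiB
  have hcard : (insert i B.toFinset).card = d + 2 := by
    rw [Finset.card_insert_of_notMem (by simpa using hiB),
      (span_image_eq_top_iff_card_eq_finrank (s := B.toFinset) (by simpa using hB)).1
        (by simpa using htop)]
    simp
  have hsub : ((insert i B.toFinset : Finset (Fin n)) : Set (Fin n)) ⊆ contactSet 𝐯 h f := by
    simpa using Set.insert_subset hi hBf
  obtain ⟨N, hN₀, hN, c, hc⟩ := hh _ hcard (not_affineIndependent_heightLift hcard hsub)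
  exact hN₀ (eq_zero_of_dotProduct_heightLift_eq htop hN fun j hj => hc j (by simp [hj]))

lemma Cell.ofSign_mul {η : ℝ} (hη : 0 < η) (w : Fin n → ℝ) :
    Cell.ofSign (fun i => η * w i) = Cell.ofSign w := by
  ext i <;> simp [Cell.ofSign, hη, hη.ne']

lemma Cell.exists_weights_subset_of_isUpperFace {T : Cell n}
    (hT : IsUpperFace (zonotope fun i => projLift (heightLift a h i))
      (T.toSet fun i => projLift (heightLift a h i))) :
    ∃ f, T.weights ⊆ (Cell.cut 𝐯 h f).weights := by
  obtain ⟨y, hy, hTy⟩ := hT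
  obtain ⟨f, hf⟩ := exists_dual_of_upperNormal a h hy.ne'
  refine ⟨f, (Cell.weights_subset_of_toSet_eq_face hTy).trans_eq ?_⟩
  simp only [hf, Cell.ofSign_mul hy, Cell.cut]

lemma Cell.isUpperFace_cut (f : Module.Dual ℝ (Fin (d + 1) → ℝ)) :
    IsUpperFace (zonotope fun i => projLift (heightLift a h i))
      ((Cell.cut 𝐯 h f).toSet fun i => projLift (heightLift a h i)) := by
  obtain ⟨y, hy, hyf⟩ := exists_upperNormal_of_dual a h f
  refine ⟨y, hy ▸ one_pos, ?_⟩
  simp only [zonotope_face_eq_toSet, hyf, Cell.cut]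

lemma mem_regularTiling_iff (hsimple : IsSimpleDual 𝐯 h) {T : Cell n} :
    T ∈ regularTiling a h ↔ ∃ f, IsDualVertex 𝐯 h f ∧ Cell.cut 𝐯 h f = T := by
  have hspan {T : Cell n} (hT : LinearIndepOn ℝ 𝐯 (T.dirs : Set (Fin n))) :
      Submodule.span ℝ (𝐯 '' (T.dirs : Set (Fin n))) = ⊤ ↔ T.dirs.card = d + 1 := by
    rw [span_image_eq_top_iff_card_eq_finrank hT, Module.finrank_fin_fun]
  constructor
  · rintro ⟨hcard, hind, hface⟩
    rw [affineIndependent_iff_linearIndepOn_projLift] at hind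
    obtain ⟨f, hTf⟩ := Cell.exists_weights_subset_of_isUpperFace hface
    have hsub : (T.dirs : Set (Fin n)) ⊆ contactSet 𝐯 h f :=
      fun i hi => (sub_eq_zero.1 (Cell.eq_zero_of_weights_subset hTf hi)).symm
    have htop := (hspan hind).2 hcard
    have hf : IsDualVertex 𝐯 h f :=
      top_unique (htop.symm.trans_le (Submodule.span_mono (Set.image_mono hsub)))
    have hdirs := eq_of_subset_of_span_eq_top (hsimple f hf) hsub htop
    refine ⟨f, hf, (Cell.eq_ofSign_of_weights_subset hTf fun i hi => ?_).symm⟩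
    exact hdirs.ge (sub_eq_zero.1 hi).symm
  · rintro ⟨f, hf, rfl⟩
    have hind := hsimple f hf
    rw [← Cell.coe_dirs_cut] at hind
    refine ⟨(hspan hind).1 ?_, (affineIndependent_iff_linearIndepOn_projLift a _).2 hind,
      Cell.isUpperFace_cut f⟩
    rw [Cell.coe_dirs_cut, hf]

lemma IsGenericForTiling.isDualGeneric (hx : IsGenericForTiling a (regularTiling a h) x)
    (hsimple : IsSimpleDual 𝐯 h) : IsDualGeneric 𝐯 h (projLift x) := by
  intro f hf b hb hxb i hib
  by_contra hi
  obtain ⟨N, -, hN⟩ := exists_dual_ker_eq_span_diff (hsimple f hf) hf hb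
  have hNi : N (projLift (a i)) ≠ 0 := fun hNi => hi (hN.le hNi)
  have hfi : h i - f (projLift (a i)) ≠ 0 := fun hfi =>
    hi (Submodule.subset_span ⟨i, ⟨(sub_eq_zero.1 hfi).symm, hib⟩, rfl⟩)
  -- The sign of `σ` makes `i` an obstacle on the line from `f` in the direction `σ • N`.
  let σ := (h i - f (projLift (a i))) * N (projLift (a i))
  have hσN : ∀ j ∈ contactSet 𝐯 h f \ {b}, (σ • N) (projLift (a j)) = 0 := fun j hj => by
    rw [LinearMap.smul_apply, LinearMap.mem_ker.1 (hN.ge (Submodule.subset_span ⟨j, hj, rfl⟩)),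
      smul_zero]
  have hσi : 0 < (h i - f (projLift (a i))) * (σ • N) (projLift (a i)) := by
    rw [LinearMap.smul_apply, smul_eq_mul, mul_left_comm]
    exact mul_self_pos.2 (mul_ne_zero hfi hNi)
  obtain ⟨s, -, b', hf', hp, -⟩ := exists_isPivot hsimple hf hb hσN ⟨i, hσi⟩
  obtain ⟨F, hF, hshared⟩ := hp.exists_isSharedFacet
    ((mem_regularTiling_iff hsimple).2 ⟨_, hf, rfl⟩)
    ((mem_regularTiling_iff hsimple).2 ⟨_, hf', rfl⟩)
  exact hx _ _ _ hshared (projLift_mem_span_image_iff.1 (hF ▸ hxb))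

lemma IsPivot.adj_orientedAdjacencyGraph {f f' : Module.Dual ℝ (Fin (d + 1) → ℝ)} {b b' : Fin n}
    (hp : IsPivot 𝐯 h f f' b b') (hf : IsDualVertex 𝐯 h f)
    (hlt : f (projLift x) < f' (projLift x)) {P : Set (Cell n)} (hfP : Cell.cut 𝐯 h f ∈ P)
    (hfP' : Cell.cut 𝐯 h f' ∈ P) :
    (orientedAdjacencyGraph a P x).Adj (Cell.cut 𝐯 h f') (Cell.cut 𝐯 h f) := by
  obtain ⟨F, hF, hT, hT', hne, hfacet, hfacet'⟩ := hp.exists_isSharedFacet hfP hfP'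
  refine ⟨F, ⟨hT', hT, hne.symm, hfacet', hfacet⟩, fun N _ hNF z hz z' hz' => ?_⟩
  have hDx : 0 < (f' - f) (projLift x) := sub_pos.2 hlt
  have hD₀ : f' - f ≠ 0 := fun hD => hDx.ne' (by rw [hD, LinearMap.zero_apply])
  have hD : ∀ i ∈ contactSet 𝐯 h f \ {b}, (f' - f) (projLift (a i)) = 0 := fun i hi => by
    have hi' : i ∈ contactSet 𝐯 h f' := hp.contactSet_eq ▸ Set.mem_insert_of_mem b' hi
    exact sub_eq_zero.2 ((mem_contactSet.1 hi').trans (mem_contactSet.1 hi.1).symm)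
  obtain ⟨t, ht⟩ := exists_eq_smul_of_span_insert_eq_top (M := dotProductEquiv ℝ _ N)
    (Set.forall_mem_image.2 fun i hi => hNF i (Finset.mem_coe.1 (hF ▸ hi)))
    (Set.forall_mem_image.2 hD) hD₀ (hf.span_insert_contactSet_diff hp.mem)
  have hNt (y : Fin (d + 1) → ℝ) : N ⬝ᵥ y = t * (f' - f) y := LinearMap.congr_fun ht y
  have hDz : 0 < (f' - f) (z' - z) := by
    rw [map_sub, sub_pos]
    exact Cell.sub_apply_lt_of_mem_interior_cut hD₀ (interior_subset hz') hz
  rw [hNt, hNt, sign_mul, sign_mul, sign_pos hDx, sign_pos hDz]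

variable (h) in
lemma exists_isDualVertex_supportedOn (ha : affineSpan ℝ (Set.range a) = ⊤)
    (hx : x ∈ convexHull ℝ (Set.range a)) :
    ∃ f, IsDualVertex 𝐯 h f ∧ (Cell.cut 𝐯 h f).SupportedOn a x := by
  obtain ⟨J, hJ, hxJ⟩ := exists_linearIndepOn_projLift_of_mem_convexHull hx
  obtain ⟨f, hf, hJf⟩ :=
    exists_isDualVertex_contactSet_superset hJ (span_range_projLift_eq_top ha) h
  refine ⟨f, hf, convexHull_mono (Set.image_mono (hJf.trans fun i hi => ?_)) hxJ⟩
  rw [Cell.coe_base_union_dirs_cut]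
  exact (mem_contactSet.1 hi).le

lemma exists_supportedOn_predecessor (hsimple : IsSimpleDual 𝐯 h)
    (hx : IsGenericForTiling a (regularTiling a h) x) {f : Module.Dual ℝ (Fin (d + 1) → ℝ)}
    (hf : IsDualVertex 𝐯 h f) (hfx : (Cell.cut 𝐯 h f).SupportedOn a x)
    (hord : (Cell.cut 𝐯 h f).order ≠ 0) :
    ∃ f', IsDualVertex 𝐯 h f' ∧ (Cell.cut 𝐯 h f').SupportedOn a x ∧
      (orientedAdjacencyGraph a (regularTiling a h) x).Adj
        (Cell.cut 𝐯 h f') (Cell.cut 𝐯 h f) ∧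
      f (projLift x) < f' (projLift x) ∧
      (Cell.cut 𝐯 h f').order ≤ (Cell.cut 𝐯 h f).order := by
  obtain ⟨μ, hμ⟩ := Cell.supportedOn_cut_iff.1 hfx
  have hlt : ∃ i, f (projLift (a i)) < h i := by
    simpa [Cell.order_cut_eq_zero_iff] using hord
  obtain ⟨f', b, b', hf', hp, hff', hsupp, hbase⟩ := exists_ascending_pivot hsimple hf
    (e := LinearMap.proj (Fin.last d)) (by simp) (hx.isDualGeneric hsimple) hμ hlt
  have hmem {g : Module.Dual ℝ (Fin (d + 1) → ℝ)} (hg : IsDualVertex 𝐯 h g) :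
      Cell.cut 𝐯 h g ∈ regularTiling a h :=
    (mem_regularTiling_iff hsimple).2 ⟨g, hg, rfl⟩
  exact ⟨f', hf', Cell.supportedOn_cut_iff.2 hsupp,
    hp.adj_orientedAdjacencyGraph hf hff' (hmem hf) (hmem hf'), hff',
    Cell.order_cut_le_order_cut hbase⟩

lemma exists_isDirectedPath_of_supportedOn (hsimple : IsSimpleDual 𝐯 h)
    (hx : IsGenericForTiling a (regularTiling a h) x) {T : Cell n} (hT : T ∈ regularTiling a h)
    (hTx : T.SupportedOn a x) :
    ∃ T₀ p, (T₀ ∈ regularTiling a h ∧ T₀.order = 0 ∧ T₀.SupportedOn a x) ∧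
      IsDirectedPath (orientedAdjacencyGraph a (regularTiling a h) x) T₀ T p ∧
      ∀ T' ∈ p, T' ∈ regularTiling a h ∧ T'.SupportedOn a x ∧ T'.order ≤ T.order := by
  let φ (T : Cell n) : ℝ :=
    Function.invFunOn (Cell.cut 𝐯 h) {f | IsDualVertex 𝐯 h f} T (projLift x)
  have hφ {f : Module.Dual ℝ (Fin (d + 1) → ℝ)} (hf : IsDualVertex 𝐯 h f) :
      φ (Cell.cut 𝐯 h f) = f (projLift x) :=
    LinearMap.congr_fun ((Cell.injOn_cut _ h).leftInvOn_invFunOn hf) _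
  obtain ⟨T₀, p, ⟨⟨hT₀, hT₀x⟩, hord⟩, hp, hall⟩ :=
    exists_isDirectedPath_of_ascent (G := orientedAdjacencyGraph a (regularTiling a h) x)
      (P := fun T => T ∈ regularTiling a h ∧ T.SupportedOn a x) (Z := fun T => T.order = 0)
      (φ := φ) (ord := Cell.order) (fun T ⟨hT, hTx⟩ hord => by
        obtain ⟨f, hf, rfl⟩ := (mem_regularTiling_iff hsimple).1 hT
        obtain ⟨f', hf', hfx', hadj, hlt, hle⟩ :=
          exists_supportedOn_predecessor hsimple hx hf hTx hord
        exact ⟨_, ⟨(mem_regularTiling_iff hsimple).2 ⟨f', hf', rfl⟩, hfx'⟩, hadj,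
          by rwa [hφ hf, hφ hf'], hle⟩) ⟨hT, hTx⟩
  exact ⟨T₀, p, ⟨hT₀, hord, hT₀x⟩, hp,
    fun T' hT' => ⟨(hall T' hT').1.1, (hall T' hT').1.2, (hall T' hT').2.2⟩⟩

lemma eq_of_order_eq_zero_of_supportedOn (hsimple : IsSimpleDual 𝐯 h)
    (hx : IsGenericForTiling a (regularTiling a h) x) {T T' : Cell n}
    (hT : T ∈ regularTiling a h ∧ T.order = 0 ∧ T.SupportedOn a x)
    (hT' : T' ∈ regularTiling a h ∧ T'.order = 0 ∧ T'.SupportedOn a x) : T = T' := by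
  obtain ⟨hmem, hord, hTx⟩ := hT
  obtain ⟨hmem', hord', hTx'⟩ := hT'
  obtain ⟨f, hf, rfl⟩ := (mem_regularTiling_iff hsimple).1 hmem
  obtain ⟨f', hf', rfl⟩ := (mem_regularTiling_iff hsimple).1 hmem'
  obtain ⟨μ, hμ⟩ := Cell.supportedOn_cut_iff.1 hTx
  obtain ⟨μ', hμ'⟩ := Cell.supportedOn_cut_iff.1 hTx'
  rw [hf.eq_of_le hsimple hf' (Cell.order_cut_eq_zero_iff.1 hord)
    (Cell.order_cut_eq_zero_iff.1 hord') (hx.isDualGeneric hsimple) hμ hμ']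

end Tiling

theorem proposition5 {n d : ℕ} (a : Fin n → Fin d → ℝ)
    (ha : affineSpan ℝ (Set.range a) = ⊤)
    (h : Fin n → ℝ) (hh : IsGenericHeight a h)
    (x : Fin d → ℝ) (hx : x ∈ convexHull ℝ (Set.range a))
    (hxg : IsGenericForTiling a (regularTiling a h) x) :
    (∃! T₀ : Cell n, T₀ ∈ regularTiling a h ∧ T₀.order = 0 ∧ T₀.SupportedOn a x) ∧
    ∀ T₀ : Cell n, T₀ ∈ regularTiling a h → T₀.order = 0 → T₀.SupportedOn a x →
      ∀ T' : Cell n, T' ∈ regularTiling a h → T'.SupportedOn a x →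
        ∃ p : List (Cell n),
          IsDirectedPath (orientedAdjacencyGraph a (regularTiling a h) x) T₀ T' p ∧
          ∀ T ∈ p, T ∈ regularTiling a h ∧ T.SupportedOn a x ∧ T.order ≤ T'.order := by
  have hsimple := hh.isSimpleDual
  refine ⟨?_, fun T₀ hT₀ hord hT₀x T' hT' hTx' => ?_⟩
  · obtain ⟨f, hf, hfx⟩ := exists_isDualVertex_supportedOn h ha hx
    obtain ⟨T₀, -, hT₀, -⟩ := exists_isDirectedPath_of_supportedOn hsimple hxg
      ((mem_regularTiling_iff hsimple).2 ⟨f, hf, rfl⟩) hfx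
    exact ⟨T₀, hT₀, fun T hT => eq_of_order_eq_zero_of_supportedOn hsimple hxg hT hT₀⟩
  · obtain ⟨T₁, p, hT₁, hp, hall⟩ :=
      exists_isDirectedPath_of_supportedOn hsimple hxg hT' hTx'
    obtain rfl := eq_of_order_eq_zero_of_supportedOn hsimple hxg ⟨hT₀, hord, hT₀x⟩ hT₁
    exact ⟨p, hp, hall⟩
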